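/- Let $\sigma_1,\dots,\sigma_d\ge 0$ be the singular values of a matrix, let $k\ge 0$ be an integer and put $\beta_l=(\sigma_l^{2k})^2$. Fix an index $i$ such that $\sigma_i>0$ and $\sigma_l>0$ for at least one $l\ne i$, and let $$\alpha_i=\frac12\,\frac{\big(\sum_{l\ne i}\beta_l\big)^2}{\sum_{l\ne i}\beta_l^2},\qquad \gamma_i=\frac1{\beta_i}\,\frac{\sum_{l\ne i}\beta_l^2}{\sum_{l\ne i}\beta_l}.$$ Let $u\sim\mathcal G(\tfrac12,2)$ and $v_i\sim\mathcal G(\alpha_i,2\gamma_i)$ be independent, where $\mathcal G(a,\theta)$ is the Gamma distribution with shape $a$ and scale $\theta$, and let $x_i=\frac{u}{u+v_i}$. Then $x_i$ has the probability density $$x_i^\bullet(z)=\frac{\gamma_i}{(1-(1-\gamma_i)z)^2}\;\mathcal B\Big(\frac{\gamma_i z}{1-(1-\gamma_i)z};\tfrac12,\alpha_i\Big),$$ where $\mathcal B(\,\cdot\,;\tfrac12,\alpha_i)$ is the density of the Beta distribution with parameters $\tfrac12,\alpha_i$ (so $x_i^\bullet$ vanishes outside $[0,1]$). Let ${}_2F_1(a,b;c;x)$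 be, for real $x<1$, the analytic continuation to $(-\infty,1)$ of the Gauss series $\sum_n\frac{(a)_n(b)_n}{(c)_n}\frac{x^n}{n!}$, and, for $x=1$, the sum of that series. The functions $z\,x_i^\bullet(z)$ and $z^2x_i^\bullet(z)$ are integrable on $[0,1]$, and with $\lambda_i=\int_0^1 z\,x_i^\bullet(z)\,\mathrm dz$ the variance $\omega_i^2$ of $x_i$ is $$\omega_i^2=\mathbb E(x_i^2)-(\mathbb E x_i)^2=\int_0^1 z^2x_i^\bullet(z)\,\mathrm dz-\lambda_i^2$$ $$=\frac1{\sqrt\pi}\,\gamma_i^{1/2}\,\frac{\Gamma(\frac12+\alpha_i)}{\Gamma(\alpha_i)}\Big(\tfrac25\;{}_2F_1\big(\tfrac52,1-\alpha_i;\tfrac72;1\big)\;{}_2F_1\big(\tfrac52,\tfrac32+\alpha_i;\tfrac52+\alpha_i;1-\gamma_i\big)$$ $$\qquad+\tfrac27(\gamma_i-1)\;{}_2F_1\big(\tfrac72,1-\alpha_i;\tfrac92;1\big)\;{}_2F_1\big(\tfrac72,\tfrac32+\alpha_i;\tfrac72+\alpha_i;1-\gamma_i\big)\Big)-\lambda_i^2,$$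 where $$\lambda_i=\gamma_i^{1/2}\,\frac{\Gamma(\frac32)\Gamma(\frac12+\alpha_i)}{\Gamma(\frac12)\Gamma(\frac32+\alpha_i)}\;{}_2F_1\big(\tfrac32,\tfrac12+\alpha_i;\tfrac32+\alpha_i;1-\gamma_i\big).$$ To five decimals the three constants are $\frac1{\sqrt\pi}\approx0.56419$, $\frac25=0.4$ and $\frac27\approx0.28571$ (each error is at most $5\cdot10^{-6}$). -/

import Mathlib

open MeasureTheory ProbabilityTheory Set

noncomputable section

/-- `f` is a real-analytic continuation to `(-∞, 1)` of the Gauss hypergeometric series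
`∑ (a)ₙ (b)ₙ / (c)ₙ xⁿ / n!` (Mathlib's `ordinaryHypergeometric`), which converges for `|x| < 1`. -/
def IsGaussContinuation (a b c : ℝ) (f : ℝ → ℝ) : Prop :=
  AnalyticOnNhd ℝ f (Iio 1) ∧ ∀ x : ℝ, |x| < 1 → f x = ordinaryHypergeometric a b c x

open Classical in
/-- The hypergeometric function `₂F₁(a, b; c; x)` for real `x ≤ 1`: on `(-∞, 1)` it is the analytic
continuation of the Gauss series, at `x = 1` it is the sum of the Gauss series. Values at `x > 1`,
on the branch cut, carry no meaning. -/
def hyp2F1 (a b c x : ℝ) : ℝ :=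
  if h : x < 1 ∧ ∃ f : ℝ → ℝ, IsGaussContinuation a b c f then h.2.choose x
  else ordinaryHypergeometric a b c x

/-- The analytic continuation is unique, so `hyp2F1` does not depend on any choice. -/
theorem hyp2F1_eq_of_isGaussContinuation {a b c : ℝ} {f : ℝ → ℝ}
    (hf : IsGaussContinuation a b c f) {x : ℝ} (hx : x < 1) : hyp2F1 a b c x = f x := by
  have h : x < 1 ∧ ∃ f : ℝ → ℝ, IsGaussContinuation a b c f := ⟨hx, f, hf⟩
  have hg := h.2.choose_spec
  rw [hyp2F1, dif_pos h]
  refine hg.1.eqOn_of_preconnected_of_eventuallyEq hf.1 isPreconnected_Iio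
    (show (0 : ℝ) ∈ Iio 1 by simp) ?_ hx
  filter_upwards [Metric.ball_mem_nhds (0 : ℝ) one_pos] with y hy
  have hy' : |y| < 1 := by simpa using hy
  rw [hg.2 y hy', hf.2 y hy']

/-- The Gamma distribution `𝒢(a, θ)` with shape `a` and *scale* `θ`
(Mathlib's `gammaMeasure` takes the rate `θ⁻¹`). -/
def gammaLaw (a θ : ℝ) : Measure ℝ := gammaMeasure a θ⁻¹

/-- `β_l = (σ_l ^ (2k))²`. -/
def specWeight {d : ℕ} (σ : Fin d → ℝ) (k : ℕ) (l : Fin d) : ℝ := (σ l ^ (2 * k)) ^ 2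

/-- `α_i = ½ (∑_{l ≠ i} β_l)² / ∑_{l ≠ i} β_l²`. -/
def specShape {d : ℕ} (σ : Fin d → ℝ) (k : ℕ) (i : Fin d) : ℝ :=
  1 / 2 * ((∑ l ∈ Finset.univ.erase i, specWeight σ k l) ^ 2
    / ∑ l ∈ Finset.univ.erase i, specWeight σ k l ^ 2)

/-- `γ_i = (1 / β_i) (∑_{l ≠ i} β_l²) / ∑_{l ≠ i} β_l`. -/
def specScale {d : ℕ} (σ : Fin d → ℝ) (k : ℕ) (i : Fin d) : ℝ :=
  1 / specWeight σ k i * ((∑ l ∈ Finset.univ.erase i, specWeight σ k l ^ 2)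
    / ∑ l ∈ Finset.univ.erase i, specWeight σ k l)

/-- The density `x•(z) = γ / (1 - (1 - γ) z)² · ℬ(γ z / (1 - (1 - γ) z); ½, α)`, where `ℬ(·; ½, α)`
is the Beta density. -/
def specDensity (α γ z : ℝ) : ℝ :=
  γ / (1 - (1 - γ) * z) ^ 2 * betaPDFReal (1 / 2) α (γ * z / (1 - (1 - γ) * z))

/-- `λ = ∫₀¹ z x•(z) dz`. -/
def specMean (α γ : ℝ) : ℝ := ∫ z in (0 : ℝ)..1, z * specDensity α γ z

end

/-!
Substituting `v = u (1 - z) / z` in the joint law of `u` and `v` and integrating out `u`, which is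
again Gamma distributed given `z`, shows that `u / (u + v)` has the density
`γ ^ (1/2) / B(1/2, α) * z ^ (-1/2) (1 - z) ^ (α - 1) (1 - (1 - γ) z) ^ (-(1/2 + α))`. Its moments
are therefore Euler integrals, that is, values of `₂F₁` at `1 - γ`. In the second moment, writing
one factor `1 - (1 - γ) z` out of the power splits the integral in two, and Gauss' summation at `1`
turns the Beta constants `B(5/2, α)` and `B(7/2, α)` into `₂F₁(·, 1 - α; ·; 1)`.
-/

open scoped Nat Topology

section BinomialSeries

theorem multichoose_eq_inv_factorial_mul_ascPochhammer {K : Type*} [Field K] [CharZero K]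
    [BinomialRing K] (q : K) (n : ℕ) :
    Ring.multichoose q n = (n ! : K)⁻¹ * (ascPochhammer K n).eval q := by
  have h := Ring.factorial_nsmul_multichoose_eq_ascPochhammer q n
  rw [Polynomial.ascPochhammer_smeval_eq_eval, nsmul_eq_mul] at h
  rw [← h, inv_mul_cancel_left₀ (by exact_mod_cast n.factorial_ne_zero)]

theorem abs_multichoose_le (q : ℝ) (n : ℕ) : |Ring.multichoose q n| ≤ Ring.multichoose |q| n := by
  have habs (n : ℕ) : |(ascPochhammer ℝ n).eval q| ≤ (ascPochhammer ℝ n).eval |q| := by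
    induction n with
    | zero => simp
    | succ n ih =>
      rw [ascPochhammer_succ_eval, ascPochhammer_succ_eval, abs_mul]
      exact mul_le_mul ih ((abs_add_le q n).trans_eq (by rw [Nat.abs_cast])) (abs_nonneg _)
        ((abs_nonneg _).trans ih)
  rw [multichoose_eq_inv_factorial_mul_ascPochhammer, abs_mul, abs_of_nonneg (by positivity),
    multichoose_eq_inv_factorial_mul_ascPochhammer]
  exact mul_le_mul_of_nonneg_left (habs n) (by positivity)

theorem hasSum_multichoose_mul_pow (q : ℝ) {y : ℝ} (hy : |y| < 1) :
    HasSum (fun n : ℕ => Ring.multichoose q n * y ^ n) ((1 - y) ^ (-q)) := by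
  have h := (Real.one_div_one_sub_rpow_hasFPowerSeriesOnBall_zero q).hasSum (y := y)
    (by simpa [Metric.mem_eball, edist_dist, Real.dist_eq, ENNReal.ofReal_lt_one] using hy)
  rw [zero_add, one_div, ← Real.rpow_neg (by linarith [(abs_lt.1 hy).2])] at h
  refine h.congr_fun fun n => ?_
  have hchoose : Ring.choose (q + n - 1) n = Ring.multichoose q n := by
    rw [Ring.choose]
    congr 1
    ring
  simp [hchoose, mul_comm]

variable {Ω : Type*} [MeasurableSpace Ω] {μ : Measure Ω} {w g : Ω → ℝ}

/- Replacing `q` by `|q|` and `g` by `|g|` makes every term of the binomial series nonnegative, so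
`|w| (1 - |g|) ^ (-|q|)` dominates all partial sums. -/
theorem hasSum_integral_mul_one_sub_rpow {q : ℝ} (hw : AEStronglyMeasurable w μ)
    (hg : AEStronglyMeasurable g μ) (hg_lt : ∀ᵐ t ∂μ, |g t| < 1)
    (hint : Integrable (fun t => w t * (1 - |g t|) ^ (-|q|)) μ) :
    HasSum (fun n : ℕ => Ring.multichoose q n * ∫ t, w t * g t ^ n ∂μ)
      (∫ t, w t * (1 - g t) ^ (-q) ∂μ) := by
  have hmajor : ∀ᵐ t ∂μ, HasSum (fun n : ℕ => |w t| * (Ring.multichoose |q| n * |g t| ^ n))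
      (|w t| * (1 - |g t|) ^ (-|q|)) := by
    filter_upwards [hg_lt] with t ht
    exact (hasSum_multichoose_mul_pow |q| (by rwa [abs_abs])).mul_left _
  have key := hasSum_integral_of_dominated_convergence (μ := μ)
    (F := fun (n : ℕ) t => Ring.multichoose q n * (w t * g t ^ n))
    (f := fun t => w t * (1 - g t) ^ (-q))
    (fun (n : ℕ) t => |w t| * (Ring.multichoose |q| n * |g t| ^ n))
    (fun n => (hw.mul (hg.pow n)).const_mul _) (fun n => .of_forall fun t => ?_)
    (hmajor.mono fun t ht => ht.summable) ?_ ?_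
  · simpa only [integral_const_mul] using key
  · rw [Real.norm_eq_abs, abs_mul, abs_mul, abs_pow, mul_left_comm]
    gcongr
    exact abs_multichoose_le q n
  · refine hint.abs.congr ?_
    filter_upwards [hmajor, hg_lt] with t ht hlt
    rw [ht.tsum_eq, abs_mul, abs_of_nonneg (Real.rpow_nonneg (sub_nonneg.2 hlt.le) _)]
  · filter_upwards [hg_lt] with t ht
    exact ((hasSum_multichoose_mul_pow q ht).mul_left (w t)).congr_fun fun n => by ring

theorem analyticAt_integral_mul_one_sub_mul_rpow {M : ℝ} (hw : Integrable w μ)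
    (hg : AEStronglyMeasurable g μ) (hM : ∀ᵐ t ∂μ, |g t| ≤ M) (q : ℝ) :
    AnalyticAt ℝ (fun h => ∫ t, w t * (1 - h * g t) ^ (-q) ∂μ) 0 := by
  refine ⟨.ofScalars ℝ fun n => Ring.multichoose q n * ∫ t, w t * g t ^ n ∂μ,
    hasFPowerSeriesAt_iff.2 ?_⟩
  have hsmall : ∀ᶠ h : ℝ in 𝓝 0, |h| * M < 1 / 2 :=
    (Continuous.tendsto' (by fun_prop) 0 0 (by simp)).eventually_lt_const one_half_pos
  filter_upwards [hsmall] with h hh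
  have hbound : ∀ᵐ t ∂μ, |h * g t| ≤ 1 / 2 := by
    filter_upwards [hM] with t ht
    exact (abs_mul h _).trans_le ((mul_le_mul_of_nonneg_left ht (abs_nonneg h)).trans hh.le)
  have hint : Integrable (fun t => w t * (1 - |h * g t|) ^ (-|q|)) μ := by
    refine hw.mul_bdd (c := (1 / 2) ^ (-|q|))
      (AEMeasurable.aestronglyMeasurable (by fun_prop)) ?_
    filter_upwards [hbound] with t ht
    have hhalf : 1 / 2 ≤ 1 - |h * g t| := by linarith
    rw [Real.norm_eq_abs, abs_of_nonneg (Real.rpow_nonneg (by linarith) _)]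
    exact Real.rpow_le_rpow_of_nonpos one_half_pos hhalf (neg_nonpos.2 (abs_nonneg q))
  have hsum := hasSum_integral_mul_one_sub_rpow hw.aestronglyMeasurable (hg.const_mul h)
    (hbound.mono fun t ht => ht.trans_lt one_half_lt_one) hint
  rw [zero_add]
  refine hsum.congr_fun fun n => ?_
  simp only [mul_pow, mul_left_comm _ (h ^ n), integral_const_mul,
    FormalMultilinearSeries.coeff_ofScalars, smul_eq_mul]

end BinomialSeries

section IntegralOverUnitInterval

variable {μ : Measure ℝ} {w : ℝ → ℝ}

theorem one_sub_mul_pos {x t : ℝ} (hx : x < 1) (ht : t ∈ Icc (0 : ℝ) 1) : 0 < 1 - x * t := by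
  rcases le_total x 0 with h | h <;> nlinarith [ht.1, ht.2]

theorem exists_abs_one_sub_mul_rpow_le {x : ℝ} (hx : x < 1) (q : ℝ) :
    ∃ C, ∀ t ∈ Icc (0 : ℝ) 1, |(1 - x * t) ^ q| ≤ C :=
  isCompact_Icc.exists_bound_of_continuousOn <|
    ContinuousOn.rpow_const (by fun_prop) fun _ ht => .inl (one_sub_mul_pos hx ht).ne'

theorem integrable_mul_one_sub_mul_rpow (hμ : ∀ᵐ t ∂μ, t ∈ Icc (0 : ℝ) 1) (hw : Integrable w μ)
    {x : ℝ} (hx : x < 1) (q : ℝ) : Integrable (fun t => w t * (1 - x * t) ^ q) μ := by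
  obtain ⟨C, hC⟩ := exists_abs_one_sub_mul_rpow_le hx q
  exact hw.mul_bdd (Measurable.aestronglyMeasurable (by fun_prop)) (hμ.mono hC)

theorem hasSum_integral_mul_one_sub_mul_rpow (hμ : ∀ᵐ t ∂μ, t ∈ Icc (0 : ℝ) 1)
    (hw : Integrable w μ) (q : ℝ) {x : ℝ} (hx : |x| < 1) :
    HasSum (fun n : ℕ => Ring.multichoose q n * x ^ n * ∫ t, w t * t ^ n ∂μ)
      (∫ t, w t * (1 - x * t) ^ (-q) ∂μ) := by
  have habs : ∀ᵐ t ∂μ, |x * t| = |x| * t := by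
    filter_upwards [hμ] with t ht
    rw [abs_mul, abs_of_nonneg ht.1]
  have hsum := hasSum_integral_mul_one_sub_rpow (g := fun t => x * t) (q := q)
    hw.aestronglyMeasurable (by fun_prop)
    (by filter_upwards [habs, hμ] with t h ht; linarith [one_sub_mul_pos hx ht])
    ((integrable_mul_one_sub_mul_rpow hμ hw hx (-|q|)).congr <| by
      filter_upwards [habs] with t h; rw [h])
  refine hsum.congr_fun fun n => ?_
  simp only [mul_pow, mul_left_comm _ (x ^ n), integral_const_mul]
  ring

/- Near `x₀` one has `1 - x t = (1 - x₀ t) (1 - (x - x₀) g(t))` with `g(t) = t / (1 - x₀ t)`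
bounded, which moves the expansion point to `0`. -/
theorem analyticOnNhd_integral_mul_one_sub_mul_rpow (hμ : ∀ᵐ t ∂μ, t ∈ Icc (0 : ℝ) 1)
    (hw : Integrable w μ) (q : ℝ) :
    AnalyticOnNhd ℝ (fun x => ∫ t, w t * (1 - x * t) ^ (-q) ∂μ) (Iio 1) := by
  intro x₀ hx₀
  obtain ⟨C, hC⟩ := exists_abs_one_sub_mul_rpow_le hx₀ (-1)
  have hbound : ∀ᵐ t ∂μ, |t * (1 - x₀ * t) ^ (-1 : ℝ)| ≤ C := by
    filter_upwards [hμ] with t ht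
    rw [abs_mul, abs_of_nonneg ht.1]
    exact (mul_le_of_le_one_left (abs_nonneg _) ht.2).trans (hC t ht)
  have h0 := analyticAt_integral_mul_one_sub_mul_rpow
    (integrable_mul_one_sub_mul_rpow hμ hw hx₀ (-q))
    (Measurable.aestronglyMeasurable (by fun_prop)) hbound q
  have hcomp := AnalyticAt.fun_comp_of_eq (f := fun x => x - x₀) (x := x₀) h0 (by fun_prop)
    (sub_self x₀)
  refine hcomp.congr ?_
  filter_upwards [Iio_mem_nhds hx₀] with x hx
  refine integral_congr_ae ?_
  filter_upwards [hμ] with t ht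
  have hpos₀ := one_sub_mul_pos hx₀ ht
  have hfactor : 1 - (x - x₀) * (t * (1 - x₀ * t) ^ (-1 : ℝ)) = (1 - x * t) / (1 - x₀ * t) := by
    rw [Real.rpow_neg_one]
    field_simp
    ring
  rw [hfactor, Real.div_rpow (one_sub_mul_pos hx ht).le hpos₀.le, mul_assoc,
    mul_div_cancel₀ _ (Real.rpow_pos_of_pos hpos₀ _).ne']

end IntegralOverUnitInterval

section BetaIntegral

variable {p b : ℝ}

theorem ofReal_rpow_mul_one_sub_rpow (p b : ℝ) {t : ℝ} (ht : t ∈ Icc (0 : ℝ) 1) :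
    ((t ^ (p - 1) * (1 - t) ^ (b - 1) : ℝ) : ℂ) =
      (t : ℂ) ^ ((p : ℂ) - 1) * (1 - (t : ℂ)) ^ ((b : ℂ) - 1) := by
  rw [Complex.ofReal_mul, Complex.ofReal_cpow ht.1, Complex.ofReal_cpow (sub_nonneg.2 ht.2)]
  push_cast
  rfl

theorem integrableOn_rpow_mul_one_sub_rpow (hp : 0 < p) (hb : 0 < b) :
    IntegrableOn (fun t : ℝ => t ^ (p - 1) * (1 - t) ^ (b - 1)) (Ioo 0 1) := by
  have h := Complex.betaIntegral_convergent (u := p) (v := b) (by simpa) (by simpa)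
  rw [intervalIntegrable_iff_integrableOn_Ioo_of_le zero_le_one] at h
  refine IntegrableOn.congr_fun (Integrable.re h) (fun t ht => ?_) measurableSet_Ioo
  rw [← ofReal_rpow_mul_one_sub_rpow p b (Ioo_subset_Icc_self ht)]
  exact Complex.ofReal_re _

theorem integral_rpow_mul_one_sub_rpow (hp : 0 < p) (hb : 0 < b) :
    ∫ t in Ioo (0 : ℝ) 1, t ^ (p - 1) * (1 - t) ^ (b - 1) = beta p b := by
  rw [beta_eq_betaIntegralReal p b hp hb, Complex.betaIntegral,
    intervalIntegral.integral_of_le zero_le_one, integral_Ioc_eq_integral_Ioo,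
    ← setIntegral_congr_fun measurableSet_Ioo fun t ht =>
      ofReal_rpow_mul_one_sub_rpow p b (Ioo_subset_Icc_self ht),
    integral_complex_ofReal, Complex.ofReal_re]

theorem integral_rpow_mul_one_sub_rpow_mul_pow (hp : 0 < p) (hb : 0 < b) (n : ℕ) :
    ∫ t in Ioo (0 : ℝ) 1, t ^ (p - 1) * (1 - t) ^ (b - 1) * t ^ n = beta (p + n) b := by
  rw [← integral_rpow_mul_one_sub_rpow (by positivity) hb]
  refine setIntegral_congr_fun measurableSet_Ioo fun t ht => ?_
  rw [add_sub_right_comm, Real.rpow_add_natCast ht.1.ne', mul_right_comm]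

theorem beta_add_one_left (hp : 0 < p) (hb : 0 < b) :
    beta (p + 1) b = beta p b * (p / (p + b)) := by
  rw [beta, beta, add_right_comm, Real.Gamma_add_one hp.ne', Real.Gamma_add_one (by positivity)]
  have := (Real.Gamma_pos_of_pos (add_pos hp hb)).ne'
  field_simp

theorem beta_add_one_right (hp : 0 < p) (hb : 0 < b) :
    beta p (b + 1) = beta p b - beta (p + 1) b := by
  rw [beta_add_one_left hp hb, beta, beta, ← add_assoc, Real.Gamma_add_one hb.ne',
    Real.Gamma_add_one (by positivity)]
  have := (Real.Gamma_pos_of_pos (add_pos hp hb)).ne'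
  field_simp
  ring

theorem beta_one_right (hp : 0 < p) : beta p 1 = p⁻¹ := by
  rw [beta, Real.Gamma_one, Real.Gamma_add_one hp.ne']
  have := (Real.Gamma_pos_of_pos hp).ne'
  field_simp

theorem beta_add_nat_left (hp : 0 < p) (hb : 0 < b) (n : ℕ) :
    beta (p + n) b =
      beta p b * ((ascPochhammer ℝ n).eval p * ((ascPochhammer ℝ n).eval (p + b))⁻¹) := by
  induction n with
  | zero => simp
  | succ n ih =>
    rw [Nat.cast_succ, ← add_assoc, beta_add_one_left (by positivity) hb, ih,
      ascPochhammer_succ_eval, ascPochhammer_succ_eval, mul_inv, add_right_comm p b, div_eq_mul_inv]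
    ring

end BetaIntegral

section EulerIntegral

/-- The integrand of Euler's integral `∫₀¹ t ^ (p - 1) (1 - t) ^ (b - 1) (1 - x t) ^ (-q) dt`, which
represents `₂F₁(p, q; p + b; x)` up to the factor `B(p, b)`. -/
noncomputable def eulerIntegrand (p b q x t : ℝ) : ℝ :=
  t ^ (p - 1) * (1 - t) ^ (b - 1) * (1 - x * t) ^ (-q)

variable {p b q x t : ℝ}

theorem measurable_eulerIntegrand (p b q x : ℝ) : Measurable (eulerIntegrand p b q x) := by
  unfold eulerIntegrand
  fun_prop

theorem eulerIntegrand_nonneg (p b q : ℝ) (hx : x < 1) (ht : t ∈ Icc (0 : ℝ) 1) :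
    0 ≤ eulerIntegrand p b q x t := by
  have := ht.1
  have := sub_nonneg.2 ht.2
  have := one_sub_mul_pos hx ht
  unfold eulerIntegrand
  positivity

theorem pow_mul_eulerIntegrand (p b q x : ℝ) (ht : t ≠ 0) (m : ℕ) :
    t ^ m * eulerIntegrand p b q x t = eulerIntegrand (p + m) b q x t := by
  rw [eulerIntegrand, eulerIntegrand, add_sub_right_comm, Real.rpow_add_natCast ht]
  ring

theorem eulerIntegrand_eq_sub (p b q : ℝ) (hx : x < 1) (ht : t ∈ Ioo (0 : ℝ) 1) :
    eulerIntegrand p b q x t =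
      eulerIntegrand p b (q + 1) x t - x * eulerIntegrand (p + 1) b (q + 1) x t := by
  have hpos := one_sub_mul_pos hx (Ioo_subset_Icc_self ht)
  have hrpow : (1 - x * t) ^ (-q) = (1 - x * t) ^ (-(q + 1)) * (1 - x * t) := by
    rw [← Real.rpow_add_one hpos.ne', neg_add, neg_add_cancel_right]
  have hmul := pow_mul_eulerIntegrand p b (q + 1) x ht.1.ne' 1
  rw [Nat.cast_one] at hmul
  rw [← hmul, eulerIntegrand, eulerIntegrand, hrpow]
  ring

theorem integrableOn_eulerIntegrand (hp : 0 < p) (hb : 0 < b) (q : ℝ) (hx : x < 1) :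
    IntegrableOn (eulerIntegrand p b q x) (Ioo 0 1) :=
  integrable_mul_one_sub_mul_rpow
    (ae_restrict_of_forall_mem measurableSet_Ioo fun _ ht => Ioo_subset_Icc_self ht)
    (integrableOn_rpow_mul_one_sub_rpow hp hb) hx (-q)

theorem isGaussContinuation_integral_eulerIntegrand (hp : 0 < p) (hb : 0 < b) (q : ℝ) :
    IsGaussContinuation p q (p + b)
      fun x => (beta p b)⁻¹ * ∫ t in Ioo (0 : ℝ) 1, eulerIntegrand p b q x t := by
  have hmem : ∀ᵐ t ∂volume.restrict (Ioo (0 : ℝ) 1), t ∈ Icc (0 : ℝ) 1 :=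
    ae_restrict_of_forall_mem measurableSet_Ioo fun _ ht => Ioo_subset_Icc_self ht
  have hw := integrableOn_rpow_mul_one_sub_rpow hp hb
  refine ⟨analyticOnNhd_const.mul (analyticOnNhd_integral_mul_one_sub_mul_rpow hmem hw q),
    fun x hx => ?_⟩
  have hsum := (hasSum_integral_mul_one_sub_mul_rpow hmem hw q hx).mul_left (beta p b)⁻¹
  have hbeta := (beta_pos hp hb).ne'
  rw [ordinaryHypergeometric_eq_tsum]
  refine (hsum.congr_fun fun n => ?_).tsum_eq.symm
  rw [integral_rpow_mul_one_sub_rpow_mul_pow hp hb, beta_add_nat_left hp hb,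
    multichoose_eq_inv_factorial_mul_ascPochhammer, smul_eq_mul]
  field_simp

theorem integral_eulerIntegrand (hp : 0 < p) (hb : 0 < b) (q : ℝ) (hx : x < 1) :
    ∫ t in Ioo (0 : ℝ) 1, eulerIntegrand p b q x t = beta p b * hyp2F1 p q (p + b) x := by
  rw [hyp2F1_eq_of_isGaussContinuation (isGaussContinuation_integral_eulerIntegrand hp hb q) hx,
    mul_inv_cancel_left₀ (beta_pos hp hb).ne']

theorem beta_mul_hyp2F1_eq_sub (hp : 0 < p) (hb : 0 < b) (q : ℝ) (hx : x < 1) :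
    beta p b * hyp2F1 p q (p + b) x =
      beta p b * hyp2F1 p (q + 1) (p + b) x -
        x * (beta (p + 1) b * hyp2F1 (p + 1) (q + 1) (p + 1 + b) x) := by
  have hp' : 0 < p + 1 := by positivity
  rw [← integral_eulerIntegrand hp hb q hx, ← integral_eulerIntegrand hp hb (q + 1) hx,
    ← integral_eulerIntegrand hp' hb (q + 1) hx, ← integral_const_mul,
    ← integral_sub (integrableOn_eulerIntegrand hp hb _ hx)
      ((integrableOn_eulerIntegrand hp' hb _ hx).const_mul x)]
  exact setIntegral_congr_fun measurableSet_Ioo fun t ht => eulerIntegrand_eq_sub p b q hx ht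

end EulerIntegral

section GaussSum

variable {s α : ℝ}

theorem hasSum_beta_of_le_one (hs : 0 < s) (hα : 0 < α) (hα1 : α ≤ 1) :
    HasSum (fun n : ℕ => Ring.multichoose (1 - α) n * (s + n)⁻¹) (beta s α) := by
  have hmoment (n : ℕ) : ∫ t in Ioo (0 : ℝ) 1, t ^ (s - 1) * t ^ n = (s + n)⁻¹ := by
    simpa [beta_one_right (show 0 < s + n by positivity)] using
      integral_rpow_mul_one_sub_rpow_mul_pow hs one_pos n
  have habs : ∀ t ∈ Ioo (0 : ℝ) 1, |t| = t := fun t ht => abs_of_pos ht.1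
  have hsum := hasSum_integral_mul_one_sub_rpow (μ := volume.restrict (Ioo (0 : ℝ) 1))
    (w := fun t => t ^ (s - 1)) (g := id) (q := 1 - α)
    (Measurable.aestronglyMeasurable (by fun_prop)) aestronglyMeasurable_id
    (ae_restrict_of_forall_mem measurableSet_Ioo fun t ht => (habs t ht).trans_lt ht.2)
    ((integrableOn_rpow_mul_one_sub_rpow hs hα).congr_fun (fun t ht => by
      rw [id, habs t ht, abs_of_nonneg (sub_nonneg.2 hα1), neg_sub]) measurableSet_Ioo)
  simpa only [id, hmoment, neg_sub, integral_rpow_mul_one_sub_rpow hs hα] using hsum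

/- Pascal's rule for the coefficients matches `B(s, α + 1) = B(s, α) - B(s + 1, α)`. -/
theorem hasSum_beta_add_one_right (hs : 0 < s) (hα : 0 < α)
    (h : ∀ r : ℝ, 0 < r →
      HasSum (fun n : ℕ => Ring.multichoose (1 - α) n * (r + n)⁻¹) (beta r α)) :
    HasSum (fun n : ℕ => Ring.multichoose (1 - (α + 1)) n * (s + n)⁻¹) (beta s (α + 1)) := by
  have htail := (hasSum_nat_add_iff' 1).2 (h s hs)
  have hdiff := htail.sub (h (s + 1) (by positivity))
  rw [← hasSum_nat_add_iff' 1, beta_add_one_right hs hα]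
  simp only [Finset.sum_range_one, Ring.multichoose_zero_right] at hdiff ⊢
  rw [sub_right_comm] at hdiff
  refine hdiff.congr_fun fun n => ?_
  have hpascal := Ring.multichoose_succ_succ (-α) n
  rw [neg_add_eq_sub] at hpascal
  rw [hpascal, sub_add_cancel_right]
  push_cast
  ring

theorem hasSum_beta (hs : 0 < s) (hα : 0 < α) :
    HasSum (fun n : ℕ => Ring.multichoose (1 - α) n * (s + n)⁻¹) (beta s α) := by
  obtain ⟨N, hN⟩ := exists_nat_ge α
  induction N generalizing s α with
  | zero => exact absurd hα (not_lt.2 (by simpa using hN))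
  | succ N ih =>
    rcases le_or_gt α 1 with hα1 | hα1
    · exact hasSum_beta_of_le_one hs hα hα1
    · have hα' : 0 < α - 1 := sub_pos.2 hα1
      have hN' : α - 1 ≤ N := by push_cast at hN; linarith
      simpa only [sub_add_cancel] using
        hasSum_beta_add_one_right hs hα' fun r hr => ih hr hα' hN'

theorem hyp2F1_at_one (hs : 0 < s) (hα : 0 < α) :
    hyp2F1 s (1 - α) (s + 1) 1 = s * beta s α := by
  rw [hyp2F1, dif_neg (by simp), ordinaryHypergeometric_eq_tsum]
  refine (((hasSum_beta hs hα).mul_left s).congr_fun fun n => ?_).tsum_eq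
  have hratio := beta_add_nat_left hs one_pos n
  rw [beta_one_right hs, beta_one_right (by positivity)] at hratio
  rw [hratio, multichoose_eq_inv_factorial_mul_ascPochhammer, one_pow, smul_eq_mul]
  field_simp

end GaussSum

section LawOfFraction

theorem bijOn_mul_one_sub_div {u : ℝ} (hu : 0 < u) :
    BijOn (fun z => u * (1 - z) / z) (Ioo 0 1) (Ioi 0) := by
  refine InvOn.bijOn (f' := fun v => u / (u + v)) ⟨fun z hz => ?_, fun v hv => ?_⟩
    (fun z hz => ?_) fun v hv => ?_
  · have hsum : u + u * (1 - z) / z = u / z := by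
      field_simp [hz.1.ne']
      ring
    simp only [hsum]
    exact div_div_cancel₀ hu.ne'
  · have hsum : u + v ≠ 0 := (add_pos hu hv).ne'
    field_simp
    ring
  · exact div_pos (mul_pos hu (sub_pos.2 hz.2)) hz.1
  · exact ⟨div_pos hu (add_pos hu hv), (div_lt_one (add_pos hu hv)).2 (lt_add_of_pos_right u hv)⟩

theorem hasDerivAt_mul_one_sub_div (u : ℝ) {z : ℝ} (hz : z ≠ 0) :
    HasDerivAt (fun z => u * (1 - z) / z) (-(u / z ^ 2)) z := by
  refine ((((hasDerivAt_id z).const_sub 1).const_mul u).div (hasDerivAt_id z) hz).congr_deriv ?_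
  simp only [id]
  field_simp
  ring

theorem lintegral_Ioi_comp_div_add {u : ℝ} (hu : 0 < u) (g ψ : ℝ → ENNReal) :
    ∫⁻ v in Ioi (0 : ℝ), g v * ψ (u / (u + v)) =
      ∫⁻ z in Ioo (0 : ℝ) 1, ENNReal.ofReal (u / z ^ 2) * g (u * (1 - z) / z) * ψ z := by
  have hbij := bijOn_mul_one_sub_div hu
  rw [← hbij.image_eq, lintegral_image_eq_lintegral_abs_deriv_mul measurableSet_Ioo
    (fun z hz => (hasDerivAt_mul_one_sub_div u hz.1.ne').hasDerivWithinAt) hbij.injOn]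
  refine setLIntegral_congr_fun measurableSet_Ioo fun z hz => ?_
  have hsum : u + u * (1 - z) / z = u / z := by
    field_simp [hz.1.ne']
    ring
  rw [hsum, div_div_cancel₀ hu.ne', abs_neg, abs_of_pos (div_pos hu (pow_pos hz.1 2)), mul_assoc]

theorem map_div_add_prod_withDensity {f g : ℝ → ENNReal} (hf : Measurable f) (hg : Measurable g) :
    (((volume.restrict (Ioi 0)).withDensity f).prod
        ((volume.restrict (Ioi 0)).withDensity g)).map (fun p => p.1 / (p.1 + p.2)) =
      (volume.restrict (Ioo 0 1)).withDensity fun z =>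
        ∫⁻ u in Ioi (0 : ℝ), f u * (ENNReal.ofReal (u / z ^ 2) * g (u * (1 - z) / z)) := by
  refine Measure.ext_of_lintegral _ fun ψ hψ => ?_
  have hfrac : Measurable fun p : ℝ × ℝ => p.1 / (p.1 + p.2) := by fun_prop
  calc ∫⁻ z, ψ z ∂(Measure.map (fun p : ℝ × ℝ => p.1 / (p.1 + p.2)) _)
      = ∫⁻ u in Ioi (0 : ℝ), f u * ∫⁻ v in Ioi (0 : ℝ), g v * ψ (u / (u + v)) := by
        rw [lintegral_map hψ hfrac, lintegral_prod _ (by fun_prop),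
          lintegral_withDensity_eq_lintegral_mul _ hf
            (Measurable.lintegral_prod_right' (f := fun p : ℝ × ℝ => ψ (p.1 / (p.1 + p.2)))
              (hψ.comp hfrac))]
        refine lintegral_congr fun u => ?_
        rw [Pi.mul_apply, lintegral_withDensity_eq_lintegral_mul _ hg (by fun_prop)]
        rfl
    _ = ∫⁻ u in Ioi (0 : ℝ), ∫⁻ z in Ioo (0 : ℝ) 1,
          f u * (ENNReal.ofReal (u / z ^ 2) * g (u * (1 - z) / z)) * ψ z := by
        refine setLIntegral_congr_fun measurableSet_Ioi fun u hu => ?_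
        rw [lintegral_Ioi_comp_div_add hu, ← lintegral_const_mul _ (by fun_prop)]
        simp only [mul_assoc]
    _ = ∫⁻ z in Ioo (0 : ℝ) 1, (∫⁻ u in Ioi (0 : ℝ),
          f u * (ENNReal.ofReal (u / z ^ 2) * g (u * (1 - z) / z))) * ψ z := by
        rw [lintegral_lintegral_swap (by fun_prop)]
        exact lintegral_congr fun z => lintegral_mul_const _ (by fun_prop)
    _ = _ := (lintegral_withDensity_eq_lintegral_mul _
        (Measurable.lintegral_prod_left' (f := fun p : ℝ × ℝ =>
          f p.1 * (ENNReal.ofReal (p.1 / p.2 ^ 2) * g (p.1 * (1 - p.2) / p.2)))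
          (by fun_prop)) hψ).symm

end LawOfFraction

section LibbyNovick

/-- The density of the Libby–Novick (generalized three-parameter beta) distribution: the law of
`u / (u + v)` for independent Gamma variables `u` and `v` of shapes `a` and `b`, where `c` is the
ratio of the rate of `u` to the rate of `v`. -/
noncomputable def libbyNovickPDFReal (a b c : ℝ) : ℝ → ℝ :=
  (Ioo 0 1).indicator fun z => c ^ a / beta a b * eulerIntegrand a b (a + b) (1 - c) z

/-- The Libby–Novick distribution, see `libbyNovickPDFReal`. -/
noncomputable def libbyNovickMeasure (a b c : ℝ) : Measure ℝ :=
  volume.withDensity fun z => ENNReal.ofReal (libbyNovickPDFReal a b c z)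

variable {a b c : ℝ}

theorem measurable_libbyNovickPDFReal (a b c : ℝ) : Measurable (libbyNovickPDFReal a b c) :=
  ((measurable_eulerIntegrand _ _ _ _).const_mul _).indicator measurableSet_Ioo

theorem libbyNovickPDFReal_nonneg (ha : 0 < a) (hb : 0 < b) (hc : 0 < c) (z : ℝ) :
    0 ≤ libbyNovickPDFReal a b c z :=
  indicator_nonneg (fun _ hz => mul_nonneg
    (div_nonneg (Real.rpow_nonneg hc.le a) (beta_pos ha hb).le)
    (eulerIntegrand_nonneg a b (a + b) (sub_lt_self 1 hc) (Ioo_subset_Icc_self hz))) z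

theorem libbyNovickMeasure_eq_withDensity_restrict (a b c : ℝ) :
    libbyNovickMeasure a b c = (volume.restrict (Ioo 0 1)).withDensity fun z =>
      ENNReal.ofReal (c ^ a / beta a b * eulerIntegrand a b (a + b) (1 - c) z) := by
  rw [← withDensity_indicator measurableSet_Ioo, libbyNovickMeasure]
  congr with z
  by_cases hz : z ∈ Ioo (0 : ℝ) 1 <;> simp [libbyNovickPDFReal, hz]

theorem ae_mem_Ioo_libbyNovickMeasure (a b c : ℝ) :
    ∀ᵐ z ∂libbyNovickMeasure a b c, z ∈ Ioo (0 : ℝ) 1 := by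
  rw [libbyNovickMeasure_eq_withDensity_restrict]
  exact (withDensity_absolutelyContinuous _ _).ae_le (ae_restrict_mem measurableSet_Ioo)

theorem mul_div_one_sub_mul_mem_Ioo_iff (hc : 0 < c) {z : ℝ} :
    c * z / (1 - (1 - c) * z) ∈ Ioo (0 : ℝ) 1 ↔ z ∈ Ioo (0 : ℝ) 1 := by
  constructor
  · rintro ⟨h0, h1⟩
    rcases lt_trichotomy (1 - (1 - c) * z) 0 with hD | hD | hD
    · rw [div_lt_one_of_neg hD] at h1
      have hcz : c * z < 0 := ((div_pos_iff.1 h0).resolve_left fun h => h.2.not_gt hD).1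
      linarith [(pos_iff_neg_of_mul_neg hcz).1 hc]
    · simp [hD] at h0
    · rw [div_lt_one hD] at h1
      exact ⟨pos_of_mul_pos_right ((div_pos_iff_of_pos_right hD).1 h0) hc.le, by linarith⟩
  · intro hz
    have hD := one_sub_mul_pos (sub_lt_self 1 hc) (Ioo_subset_Icc_self hz)
    exact ⟨div_pos (mul_pos hc hz.1) hD, (div_lt_one hD).2 (by linarith [hz.2])⟩

theorem div_sq_mul_betaPDFReal (a b : ℝ) (hc : 0 < c) (z : ℝ) :
    c / (1 - (1 - c) * z) ^ 2 * betaPDFReal a b (c * z / (1 - (1 - c) * z)) =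
      libbyNovickPDFReal a b c z := by
  by_cases hz : z ∈ Ioo (0 : ℝ) 1
  · have hz0 := hz.1
    have hz1 := sub_pos.2 hz.2
    have hD := one_sub_mul_pos (sub_lt_self 1 hc) (Ioo_subset_Icc_self hz)
    have hcompl : 1 - c * z / (1 - (1 - c) * z) = (1 - z) / (1 - (1 - c) * z) := by
      rw [one_sub_div hD.ne']
      ring
    have hpow : (1 - (1 - c) * z) ^ (a + b) =
        (1 - (1 - c) * z) ^ (a - 1) * (1 - (1 - c) * z) ^ (b - 1) * (1 - (1 - c) * z) ^ 2 := by
      rw [← Real.rpow_add hD, ← Real.rpow_add_natCast hD.ne']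
      congr 1
      push_cast
      ring
    rw [betaPDFReal, if_pos (mem_Ioo.1 ((mul_div_one_sub_mul_mem_Ioo_iff hc).2 hz)), hcompl,
      Real.div_rpow (by positivity) hD.le, Real.div_rpow hz1.le hD.le, Real.mul_rpow hc.le hz0.le,
      libbyNovickPDFReal, indicator_of_mem hz, eulerIntegrand, Real.rpow_neg hD.le, hpow,
      Real.rpow_sub_one hc.ne']
    have := (Real.rpow_pos_of_pos hD (a - 1)).ne'
    have := (Real.rpow_pos_of_pos hD (b - 1)).ne'
    field_simp
  · rw [betaPDFReal, if_neg (by rwa [← mem_Ioo, mul_div_one_sub_mul_mem_Ioo_iff hc]), mul_zero,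
      libbyNovickPDFReal, indicator_of_notMem hz]

theorem measurable_gammaPDF (a r : ℝ) : Measurable (gammaPDF a r) :=
  (measurable_gammaPDFReal a r).ennreal_ofReal

theorem gammaPDF_ae_eq_indicator (a r : ℝ) :
    gammaPDF a r =ᵐ[volume] (Ioi 0).indicator (gammaPDF a r) := by
  filter_upwards [compl_mem_ae_iff.2 (measure_singleton (0 : ℝ))] with x hx
  rcases lt_or_gt_of_ne hx with h | h
  · rw [indicator_of_notMem (notMem_Ioi.2 h.le), gammaPDF_of_neg h]
  · rw [indicator_of_mem (mem_Ioi.2 h)]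

theorem gammaMeasure_eq_withDensity_restrict (a r : ℝ) :
    gammaMeasure a r = (volume.restrict (Ioi 0)).withDensity (gammaPDF a r) := by
  rw [gammaMeasure, withDensity_congr_ae (gammaPDF_ae_eq_indicator a r),
    withDensity_indicator measurableSet_Ioi]

theorem setLIntegral_Ioi_gammaPDF_eq_one {r : ℝ} (ha : 0 < a) (hr : 0 < r) :
    ∫⁻ x in Ioi 0, gammaPDF a r x = 1 := by
  rw [← lintegral_indicator measurableSet_Ioi,
    ← lintegral_congr_ae (gammaPDF_ae_eq_indicator a r), lintegral_gammaPDF_eq_one ha hr]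

/- The joint density of `z = u / (u + v)` and `u`: conditionally on `z`, the variable `u` is again
Gamma distributed. -/
theorem gammaPDFReal_mul_gammaPDFReal (ha : 0 < a) (hb : 0 < b) (hc : 0 < c) {s u z : ℝ}
    (hs : 0 < s) (hu : 0 < u) (hz : z ∈ Ioo (0 : ℝ) 1) :
    gammaPDFReal a (c * s) u * (u / z ^ 2 * gammaPDFReal b s (u * (1 - z) / z)) =
      c ^ a / beta a b * eulerIntegrand a b (a + b) (1 - c) z *
        gammaPDFReal (a + b) (s * (1 - (1 - c) * z) / z) u := by
  have hz0 := hz.1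
  have hz1 := sub_pos.2 hz.2
  have hD := one_sub_mul_pos (sub_lt_self 1 hc) (Ioo_subset_Icc_self hz)
  have hexp : Real.exp (-(s * (1 - (1 - c) * z) / z * u)) =
      Real.exp (-(c * s * u)) * Real.exp (-(s * (u * (1 - z) / z))) := by
    rw [← Real.exp_add]
    congr 1
    field_simp
    ring
  have hsplit {y : ℝ} (hy : 0 < y) : y ^ (a + b) = y ^ (a - 1) * y ^ (b - 1) * y ^ 2 := by
    rw [← Real.rpow_add hy, ← Real.rpow_add_natCast hy.ne']
    congr 1
    push_cast
    ring
  have hu_pow : u ^ (a + b - 1) = u ^ (a - 1) * u ^ (b - 1) * u := by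
    rw [Real.rpow_sub_one hu.ne', hsplit hu]
    field_simp
  simp only [gammaPDFReal, if_pos hu.le, if_pos (show 0 ≤ u * (1 - z) / z by positivity), hexp,
    hu_pow, eulerIntegrand, beta]
  rw [Real.mul_rpow hc.le hs.le, Real.div_rpow (by positivity) hz0.le, Real.mul_rpow hu.le hz1.le,
    Real.div_rpow (by positivity) hz0.le, Real.mul_rpow hs.le hD.le, Real.rpow_neg hD.le,
    hsplit hz0, Real.rpow_add hs]
  have := (Real.Gamma_pos_of_pos ha).ne'
  have := (Real.Gamma_pos_of_pos hb).ne'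
  have := (Real.Gamma_pos_of_pos (add_pos ha hb)).ne'
  generalize 1 - (1 - c) * z = D at hD ⊢
  have := (Real.rpow_pos_of_pos hD (a + b)).ne'
  have := (Real.rpow_pos_of_pos hz0 (a - 1)).ne'
  have := (Real.rpow_pos_of_pos hz0 (b - 1)).ne'
  field_simp

theorem setLIntegral_gammaPDF_mul_gammaPDF (ha : 0 < a) (hb : 0 < b) (hc : 0 < c) {s z : ℝ}
    (hs : 0 < s) (hz : z ∈ Ioo (0 : ℝ) 1) :
    ∫⁻ u in Ioi (0 : ℝ),
        gammaPDF a (c * s) u * (ENNReal.ofReal (u / z ^ 2) * gammaPDF b s (u * (1 - z) / z)) =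
      ENNReal.ofReal (c ^ a / beta a b * eulerIntegrand a b (a + b) (1 - c) z) := by
  have hx : 1 - c < 1 := sub_lt_self 1 hc
  have hz' := Ioo_subset_Icc_self hz
  have hrate : 0 < s * (1 - (1 - c) * z) / z :=
    div_pos (mul_pos hs (one_sub_mul_pos hx hz')) hz.1
  have hdensity : 0 ≤ c ^ a / beta a b * eulerIntegrand a b (a + b) (1 - c) z :=
    mul_nonneg (div_nonneg (Real.rpow_nonneg hc.le a) (beta_pos ha hb).le)
      (eulerIntegrand_nonneg a b (a + b) hx hz')
  calc _ = ∫⁻ u in Ioi (0 : ℝ),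
        ENNReal.ofReal (c ^ a / beta a b * eulerIntegrand a b (a + b) (1 - c) z) *
          gammaPDF (a + b) (s * (1 - (1 - c) * z) / z) u := by
        refine setLIntegral_congr_fun measurableSet_Ioi fun u hu => ?_
        have hu : 0 < u := hu
        simp only [gammaPDF]
        rw [← ENNReal.ofReal_mul (by positivity),
          ← ENNReal.ofReal_mul (gammaPDFReal_nonneg ha (mul_pos hc hs) u),
          gammaPDFReal_mul_gammaPDFReal ha hb hc hs hu hz, ENNReal.ofReal_mul hdensity]
    _ = _ := by
        rw [lintegral_const_mul _ (measurable_gammaPDF _ _),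
          setLIntegral_Ioi_gammaPDF_eq_one (add_pos ha hb) hrate, mul_one]

theorem map_div_add_prod_gammaMeasure (ha : 0 < a) (hb : 0 < b) (hc : 0 < c) {s : ℝ}
    (hs : 0 < s) :
    ((gammaMeasure a (c * s)).prod (gammaMeasure b s)).map (fun p => p.1 / (p.1 + p.2)) =
      libbyNovickMeasure a b c := by
  rw [gammaMeasure_eq_withDensity_restrict, gammaMeasure_eq_withDensity_restrict,
    map_div_add_prod_withDensity (measurable_gammaPDF _ _) (measurable_gammaPDF _ _),
    libbyNovickMeasure_eq_withDensity_restrict]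
  exact withDensity_congr_ae <| ae_restrict_of_forall_mem measurableSet_Ioo fun z hz =>
    setLIntegral_gammaPDF_mul_gammaPDF ha hb hc hs hz

variable {Ω : Type*} [MeasurableSpace Ω] {P : Measure Ω} {u v x : Ω → ℝ}

theorem hasLaw_div_add_gammaMeasure (ha : 0 < a) (hb : 0 < b) (hc : 0 < c) {s : ℝ} (hs : 0 < s)
    (hu : HasLaw u (gammaMeasure a (c * s)) P) (hv : HasLaw v (gammaMeasure b s) P)
    (huv : IndepFun u v P) :
    HasLaw (fun ω => u ω / (u ω + v ω)) (libbyNovickMeasure a b c) P := by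
  have := isProbabilityMeasure_gammaMeasure hb hs
  have := hv.isProbabilityMeasure
  have hfrac : HasLaw (fun p : ℝ × ℝ => p.1 / (p.1 + p.2)) (libbyNovickMeasure a b c)
      ((gammaMeasure a (c * s)).prod (gammaMeasure b s)) :=
    ⟨by fun_prop, map_div_add_prod_gammaMeasure ha hb hc hs⟩
  exact hfrac.fun_comp ((indepFun_iff_hasLaw_prodMk_prod hu hv).1 huv)

theorem memLp_of_hasLaw_libbyNovickMeasure [IsFiniteMeasure P]
    (hx : HasLaw x (libbyNovickMeasure a b c) P) (p : ENNReal) : MemLp x p P := by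
  refine MemLp.of_bound hx.aemeasurable.aestronglyMeasurable 1 ?_
  rw [hx.ae_iff (p := fun z => ‖z‖ ≤ 1) (measurableSet_le measurable_norm measurable_const).mem]
  filter_upwards [ae_mem_Ioo_libbyNovickMeasure a b c] with z hz
  exact (Real.norm_of_nonneg hz.1.le).trans_le hz.2.le

theorem pow_mul_libbyNovickPDFReal (a b c : ℝ) (m : ℕ) {z : ℝ} (hz : z ∈ Ioo (0 : ℝ) 1) :
    z ^ m * libbyNovickPDFReal a b c z =
      c ^ a / beta a b * eulerIntegrand (a + m) b (a + b) (1 - c) z := by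
  rw [libbyNovickPDFReal, indicator_of_mem hz, mul_left_comm,
    pow_mul_eulerIntegrand _ _ _ _ hz.1.ne']

theorem intervalIntegrable_pow_mul_libbyNovickPDFReal (ha : 0 < a) (hb : 0 < b) (hc : 0 < c)
    (m : ℕ) : IntervalIntegrable (fun z => z ^ m * libbyNovickPDFReal a b c z) volume 0 1 := by
  rw [intervalIntegrable_iff_integrableOn_Ioo_of_le zero_le_one]
  exact IntegrableOn.congr_fun
    ((integrableOn_eulerIntegrand (by positivity) hb _ (sub_lt_self 1 hc)).const_mul _)
    (fun z hz => (pow_mul_libbyNovickPDFReal a b c m hz).symm) measurableSet_Ioo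

theorem integral_pow_mul_libbyNovickPDFReal (ha : 0 < a) (hb : 0 < b) (hc : 0 < c) (m : ℕ) :
    ∫ z in (0 : ℝ)..1, z ^ m * libbyNovickPDFReal a b c z = c ^ a / beta a b *
      (beta (a + m) b * hyp2F1 (a + m) (a + b) (a + m + b) (1 - c)) := by
  rw [intervalIntegral.integral_of_le zero_le_one, integral_Ioc_eq_integral_Ioo,
    setIntegral_congr_fun measurableSet_Ioo fun z => pow_mul_libbyNovickPDFReal a b c m,
    integral_const_mul, integral_eulerIntegrand (by positivity) hb _ (sub_lt_self 1 hc)]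

theorem integral_pow_of_hasLaw_libbyNovickMeasure (ha : 0 < a) (hb : 0 < b) (hc : 0 < c)
    (hx : HasLaw x (libbyNovickMeasure a b c) P) (m : ℕ) :
    ∫ ω, x ω ^ m ∂P = ∫ z in (0 : ℝ)..1, z ^ m * libbyNovickPDFReal a b c z := by
  have hsupport : (fun z => z ^ m * libbyNovickPDFReal a b c z) =
      (Ioo 0 1).indicator fun z => z ^ m * libbyNovickPDFReal a b c z := by
    ext z
    by_cases hz : z ∈ Ioo (0 : ℝ) 1 <;> simp [libbyNovickPDFReal, hz]
  calc ∫ ω, x ω ^ m ∂P = ∫ z, z ^ m ∂libbyNovickMeasure a b c :=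
        hx.integral_comp (f := fun z => z ^ m) (Measurable.aestronglyMeasurable (by fun_prop))
    _ = ∫ z, z ^ m * libbyNovickPDFReal a b c z := by
        rw [libbyNovickMeasure, integral_withDensity_eq_integral_toReal_smul
          (measurable_libbyNovickPDFReal a b c).ennreal_ofReal (by simp)]
        simp only [ENNReal.toReal_ofReal (libbyNovickPDFReal_nonneg ha hb hc _), smul_eq_mul,
          mul_comm]
    _ = _ := by
        rw [intervalIntegral.integral_of_le zero_le_one, integral_Ioc_eq_integral_Ioo, hsupport,
          integral_indicator measurableSet_Ioo, ← hsupport]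

end LibbyNovick

section SpectralParameters

variable {d : ℕ} {σ : Fin d → ℝ} {i : Fin d}

theorem specWeight_pos (k : ℕ) {l : Fin d} (hl : 0 < σ l) : 0 < specWeight σ k l :=
  pow_pos (pow_pos hl _) 2

theorem sum_erase_specWeight_pow_pos (k : ℕ) (hne : ∃ l, l ≠ i ∧ 0 < σ l) (n : ℕ) :
    0 < ∑ l ∈ Finset.univ.erase i, specWeight σ k l ^ n := by
  obtain ⟨l, hli, hl⟩ := hne
  exact Finset.sum_pos' (fun j _ => pow_nonneg (sq_nonneg _) n)
    ⟨l, Finset.mem_erase.2 ⟨hli, Finset.mem_univ l⟩, pow_pos (specWeight_pos k hl) n⟩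

theorem specShape_pos (k : ℕ) (hne : ∃ l, l ≠ i ∧ 0 < σ l) : 0 < specShape σ k i := by
  have hsum := sum_erase_specWeight_pow_pos k hne 1
  have hsum_sq := sum_erase_specWeight_pow_pos k hne 2
  simp only [pow_one] at hsum
  exact mul_pos one_half_pos (div_pos (pow_pos hsum 2) hsum_sq)

theorem specScale_pos (k : ℕ) (hi : 0 < σ i) (hne : ∃ l, l ≠ i ∧ 0 < σ l) :
    0 < specScale σ k i := by
  have hsum := sum_erase_specWeight_pow_pos k hne 1
  have hsum_sq := sum_erase_specWeight_pow_pos k hne 2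
  simp only [pow_one] at hsum
  exact mul_pos (one_div_pos.2 (specWeight_pos k hi)) (div_pos hsum_sq hsum)

end SpectralParameters

section SpectralDensity

variable {α γ : ℝ}

theorem specDensity_eq_libbyNovickPDFReal (α : ℝ) (hγ : 0 < γ) :
    specDensity α γ = libbyNovickPDFReal (1 / 2) α γ :=
  funext (div_sq_mul_betaPDFReal (1 / 2) α hγ)

theorem specMean_eq (hα : 0 < α) (hγ : 0 < γ) :
    specMean α γ = γ ^ (1 / 2 : ℝ)
      * (Real.Gamma (3 / 2) * Real.Gamma (1 / 2 + α)
        / (Real.Gamma (1 / 2) * Real.Gamma (3 / 2 + α)))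
      * hyp2F1 (3 / 2) (1 / 2 + α) (3 / 2 + α) (1 - γ) := by
  have hmoment := integral_pow_mul_libbyNovickPDFReal one_half_pos hα hγ 1
  have hshape : (1 / 2 + (1 : ℕ) : ℝ) = 3 / 2 := by norm_num
  simp only [pow_one, hshape] at hmoment
  rw [specMean, specDensity_eq_libbyNovickPDFReal α hγ, hmoment, beta, beta]
  have := (Real.Gamma_pos_of_pos hα).ne'
  field_simp

theorem integral_sq_mul_specDensity (hα : 0 < α) (hγ : 0 < γ) :
    ∫ z in (0 : ℝ)..1, z ^ 2 * specDensity α γ z =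
      1 / √Real.pi * γ ^ (1 / 2 : ℝ) * (Real.Gamma (1 / 2 + α) / Real.Gamma α) *
        (2 / 5 * hyp2F1 (5 / 2) (1 - α) (7 / 2) 1
            * hyp2F1 (5 / 2) (3 / 2 + α) (5 / 2 + α) (1 - γ)
          + 2 / 7 * (γ - 1) * hyp2F1 (7 / 2) (1 - α) (9 / 2) 1
            * hyp2F1 (7 / 2) (3 / 2 + α) (7 / 2 + α) (1 - γ)) := by
  have hmoment := integral_pow_mul_libbyNovickPDFReal one_half_pos hα hγ 2
  have hcontig := beta_mul_hyp2F1_eq_sub (p := 5 / 2) (by norm_num) hα (1 / 2 + α)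
    (sub_lt_self 1 hγ)
  have hgauss₅ : hyp2F1 (5 / 2) (1 - α) (7 / 2) 1 = 5 / 2 * beta (5 / 2) α := by
    convert hyp2F1_at_one (s := 5 / 2) (by norm_num) hα using 2
    norm_num
  have hgauss₇ : hyp2F1 (7 / 2) (1 - α) (9 / 2) 1 = 7 / 2 * beta (7 / 2) α := by
    convert hyp2F1_at_one (s := 7 / 2) (by norm_num) hα using 2
    norm_num
  have hconst : γ ^ (1 / 2 : ℝ) / beta (1 / 2) α =
      1 / √Real.pi * γ ^ (1 / 2 : ℝ) * (Real.Gamma (1 / 2 + α) / Real.Gamma α) := by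
    rw [beta, Real.Gamma_one_half_eq]
    field_simp
  rw [show (1 / 2 + (2 : ℕ) : ℝ) = 5 / 2 by norm_num, hcontig, hconst] at hmoment
  rw [specDensity_eq_libbyNovickPDFReal α hγ, hmoment, hgauss₅, hgauss₇,
    show (5 / 2 + 1 : ℝ) = 7 / 2 by norm_num,
    show 1 / 2 + α + 1 = 3 / 2 + α by ring]
  ring

theorem hasLaw_div_add_gammaLaw (hα : 0 < α) (hγ : 0 < γ) {Ω : Type*} [MeasurableSpace Ω]
    {P : Measure Ω} {u v : Ω → ℝ} (hu : HasLaw u (gammaLaw (1 / 2) 2) P)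
    (hv : HasLaw v (gammaLaw α (2 * γ)) P) (huv : IndepFun u v P) :
    HasLaw (fun ω => u ω / (u ω + v ω))
      (volume.withDensity fun z => ENNReal.ofReal (specDensity α γ z)) P := by
  have hrate : (2 : ℝ)⁻¹ = γ * (2 * γ)⁻¹ := by field_simp
  rw [gammaLaw, hrate] at hu
  rw [specDensity_eq_libbyNovickPDFReal α hγ]
  exact hasLaw_div_add_gammaMeasure one_half_pos hα hγ (by positivity) hu hv huv

end SpectralDensity

theorem abs_one_div_sqrt_pi_sub_le : |1 / √Real.pi - 0.56419| ≤ 0.000005 := by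
  have hsqrt : 0 < √Real.pi := Real.sqrt_pos.2 Real.pi_pos
  have hlower : 1 / 0.564195 ≤ √Real.pi :=
    Real.le_sqrt_of_sq_le (by norm_num; linarith [Real.pi_gt_d6])
  have hupper : √Real.pi ≤ 1 / 0.564185 :=
    Real.sqrt_le_iff.2 ⟨by norm_num, by norm_num; linarith [Real.pi_lt_d6]⟩
  have hlower' := one_div_le_one_div_of_le (by norm_num) hlower
  have hupper' := one_div_le_one_div_of_le hsqrt hupper
  rw [one_div_one_div] at hlower' hupper'
  rw [abs_le]
  constructor <;> linarith

theorem proposition3_general {α γ lam : ℝ} (hα : 0 < α) (hγ : 0 < γ) (hlam : lam = specMean α γ)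
    {Ω : Type*} [MeasurableSpace Ω] {P : Measure Ω} {u v : Ω → ℝ}
    (hu : HasLaw u (gammaLaw (1 / 2) 2) P) (hv : HasLaw v (gammaLaw α (2 * γ)) P)
    (huv : IndepFun u v P) {x : Ω → ℝ} (hx : x =ᵐ[P] fun ω => u ω / (u ω + v ω)) :
    HasLaw x (volume.withDensity fun z => ENNReal.ofReal (specDensity α γ z)) P ∧
    IntervalIntegrable (fun z => z * specDensity α γ z) volume 0 1 ∧
    IntervalIntegrable (fun z => z ^ 2 * specDensity α γ z) volume 0 1 ∧
    variance x P = (∫ ω, x ω ^ 2 ∂P) - (∫ ω, x ω ∂P) ^ 2 ∧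
    (∫ ω, x ω ^ 2 ∂P) - (∫ ω, x ω ∂P) ^ 2 =
      (∫ z in (0 : ℝ)..1, z ^ 2 * specDensity α γ z) - lam ^ 2 ∧
    (∫ z in (0 : ℝ)..1, z ^ 2 * specDensity α γ z) - lam ^ 2 =
      1 / √Real.pi * γ ^ (1 / 2 : ℝ) * (Real.Gamma (1 / 2 + α) / Real.Gamma α) *
        (2 / 5 * hyp2F1 (5 / 2) (1 - α) (7 / 2) 1
            * hyp2F1 (5 / 2) (3 / 2 + α) (5 / 2 + α) (1 - γ)
          + 2 / 7 * (γ - 1) * hyp2F1 (7 / 2) (1 - α) (9 / 2) 1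
            * hyp2F1 (7 / 2) (3 / 2 + α) (7 / 2 + α) (1 - γ)) - lam ^ 2 ∧
    lam = γ ^ (1 / 2 : ℝ)
        * (Real.Gamma (3 / 2) * Real.Gamma (1 / 2 + α)
          / (Real.Gamma (1 / 2) * Real.Gamma (3 / 2 + α)))
        * hyp2F1 (3 / 2) (1 / 2 + α) (3 / 2 + α) (1 - γ) ∧
    |1 / √Real.pi - 0.56419| ≤ 0.000005 ∧ (2 / 5 : ℝ) = 0.4 ∧
    |(2 / 7 : ℝ) - 0.28571| ≤ 0.000005 := by
  have := isProbabilityMeasure_gammaMeasure hα (inv_pos.2 (mul_pos two_pos hγ))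
  have : IsProbabilityMeasure P := HasLaw.isProbabilityMeasure (μ := gammaMeasure α (2 * γ)⁻¹) hv
  have hlaw := (hasLaw_div_add_gammaLaw hα hγ hu hv huv).congr hx
  have hlaw' : HasLaw x (libbyNovickMeasure (1 / 2) α γ) P := by
    rwa [specDensity_eq_libbyNovickPDFReal α hγ] at hlaw
  have hmoment (m : ℕ) : ∫ ω, x ω ^ m ∂P = ∫ z in (0 : ℝ)..1, z ^ m * specDensity α γ z := by
    rw [specDensity_eq_libbyNovickPDFReal α hγ]
    exact integral_pow_of_hasLaw_libbyNovickMeasure one_half_pos hα hγ hlaw' m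
  have hmean : ∫ ω, x ω ∂P = lam := by simpa only [pow_one, hlam, specMean] using hmoment 1
  have hint (m : ℕ) : IntervalIntegrable (fun z => z ^ m * specDensity α γ z) volume 0 1 := by
    rw [specDensity_eq_libbyNovickPDFReal α hγ]
    exact intervalIntegrable_pow_mul_libbyNovickPDFReal one_half_pos hα hγ m
  exact ⟨hlaw, by simpa only [pow_one] using hint 1, hint 2,
    variance_eq_sub (memLp_of_hasLaw_libbyNovickMeasure hlaw' 2), by rw [hmoment, hmean],
    by rw [integral_sq_mul_specDensity hα hγ], hlam.trans (specMean_eq hα hγ),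
    abs_one_div_sqrt_pi_sub_le, by norm_num, by norm_num [abs_le]⟩

theorem proposition3 {d : ℕ} (k : ℕ) (σ : Fin d → ℝ) (hσ : ∀ l, 0 ≤ σ l)
    (i : Fin d) (hi : 0 < σ i) (hne : ∃ l, l ≠ i ∧ 0 < σ l)
    (α γ lam : ℝ) (hα : α = specShape σ k i) (hγ : γ = specScale σ k i)
    (hlam : lam = specMean α γ)
    {Ω : Type*} [MeasurableSpace Ω] (P : Measure Ω) [IsProbabilityMeasure P] (u v : Ω → ℝ)
    (hu : HasLaw u (gammaLaw (1 / 2) 2) P) (hv : HasLaw v (gammaLaw α (2 * γ)) P)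
    (huv : IndepFun u v P) (x : Ω → ℝ) (hx : ∀ ω, x ω = u ω / (u ω + v ω)) :
    -- `x•` is the density of `x = u / (u + v)`, and it has first and second moments
    HasLaw x (volume.withDensity fun z => ENNReal.ofReal (specDensity α γ z)) P ∧
    IntervalIntegrable (fun z => z * specDensity α γ z) volume 0 1 ∧
    IntervalIntegrable (fun z => z ^ 2 * specDensity α γ z) volume 0 1 ∧
    -- `ω² = E(z²) - (E z)² = ∫₀¹ z² x•(z) dz - λ²`
    variance x P = (∫ ω, x ω ^ 2 ∂P) - (∫ ω, x ω ∂P) ^ 2 ∧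
    (∫ ω, x ω ^ 2 ∂P) - (∫ ω, x ω ∂P) ^ 2 =
      (∫ z in (0 : ℝ)..1, z ^ 2 * specDensity α γ z) - lam ^ 2 ∧
    -- the closed form of the variance
    (∫ z in (0 : ℝ)..1, z ^ 2 * specDensity α γ z) - lam ^ 2 =
      1 / √Real.pi * γ ^ (1 / 2 : ℝ) * (Real.Gamma (1 / 2 + α) / Real.Gamma α) *
        (2 / 5 * hyp2F1 (5 / 2) (1 - α) (7 / 2) 1
            * hyp2F1 (5 / 2) (3 / 2 + α) (5 / 2 + α) (1 - γ)
          + 2 / 7 * (γ - 1) * hyp2F1 (7 / 2) (1 - α) (9 / 2) 1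
            * hyp2F1 (7 / 2) (3 / 2 + α) (7 / 2 + α) (1 - γ)) - lam ^ 2 ∧
    -- the closed form of `λ` that enters it
    lam = γ ^ (1 / 2 : ℝ)
        * (Real.Gamma (3 / 2) * Real.Gamma (1 / 2 + α)
          / (Real.Gamma (1 / 2) * Real.Gamma (3 / 2 + α)))
        * hyp2F1 (3 / 2) (1 / 2 + α) (3 / 2 + α) (1 - γ) ∧
    -- the constants are `0.56419`, `0.4`, `0.28571`, rounded to five decimals
    |1 / √Real.pi - 0.56419| ≤ 0.000005 ∧ (2 / 5 : ℝ) = 0.4 ∧ |(2 / 7 : ℝ) - 0.28571| ≤ 0.000005 :=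
  proposition3_general (hα ▸ specShape_pos k hne) (hγ ▸ specScale_pos k hi hne) hlam hu hv huv
    (ae_of_all P hx)
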